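/- Let $G$ be an Abelian topological group. Write $G^\wedge$ for the group of all continuous homomorphisms $G\to\mathbb T=\{z\in\mathbb C:|z|=1\}$ with pointwise multiplication and the compact-open topology. Call $G$ \emph{reflexive} if the evaluation map $\alpha_G\colon G\to (G^\wedge)^\wedge$, $\alpha_G(x)(\chi)=\chi(x)$, is a topological isomorphism onto $(G^\wedge)^\wedge$, and \emph{protodiscrete} if the open subgroups of $G$ form a neighbourhood basis at the identity. Let $H$ be a closed subgroup of $G$ such that neither $H$ nor $G/H$ contains an infinite compact subset, and such that $H$ and $G/H$ are both reflexive and protodiscrete (with the subspace and the quotient topology, respectively). Then $G$ is reflexive and protodiscrete. Moreover, for every compact set $K\subseteq G^\wedge$ there is an open subgroup $N$ of $G$ such that $K$ is contained in the annihilator $N^\perp=\{\chi\in G^\wedge:\chi(x)=1\text{ for all }x\in N\}$. -/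

import Mathlib

noncomputable section

/-- The evaluation homomorphism of a topological group `G` into its bidual (both duals carry the
compact-open topology), sending `x` to the character `χ ↦ χ x` of the dual group. -/
def bidualEval (G : Type*) [CommGroup G] [TopologicalSpace G] [IsTopologicalGroup G] :
    G →* PontryaginDual (PontryaginDual G) where
  toFun x :=
    ({ toFun := fun χ : PontryaginDual G => χ x
       map_one' := rfl
       map_mul' := fun _ _ => rfl
       continuous_toFun :=
         (ContinuousMonoidHom.instContinuousEvalConst G Circle).continuous_eval_const x } :
      PontryaginDual G →ₜ* Circle)
  map_one' := PontryaginDual.ext fun χ => map_one χ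
  map_mul' x y := PontryaginDual.ext fun χ => map_mul χ x y

theorem bidualEval_apply {G : Type*} [CommGroup G] [TopologicalSpace G] [IsTopologicalGroup G]
    (x : G) (χ : PontryaginDual G) : bidualEval G x χ = χ x :=
  rfl

/-- A topological Abelian group is reflexive if the evaluation homomorphism is a topological
isomorphism onto the bidual. -/
def IsReflexiveGroup (G : Type*) [CommGroup G] [TopologicalSpace G] [IsTopologicalGroup G] :
    Prop :=
  IsHomeomorph (bidualEval G)

/-- A topological Abelian group is protodiscrete if the open subgroups form a basis of
neighbourhoods of the identity. -/
def IsProtodiscrete (G : Type*) [CommGroup G] [TopologicalSpace G] : Prop :=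
  (nhds (1 : G)).HasBasis (fun N : Subgroup G => IsOpen (N : Set G)) (fun N => (N : Set G))

/-- Every compact subset of the space is finite. -/
def HasNoInfiniteCompactSubsets (X : Type*) [TopologicalSpace X] : Prop :=
  ∀ K : Set X, IsCompact K → K.Finite

/-- The annihilator of a subset of `G` in the dual group. -/
def dualAnnihilator {G : Type*} [CommGroup G] [TopologicalSpace G] [IsTopologicalGroup G]
    (S : Set G) : Subgroup (PontryaginDual G) where
  carrier := {χ | ∀ x ∈ S, χ x = 1}
  one_mem' := fun _ _ => rfl
  mul_mem' := fun {χ ψ} hχ hψ x hx => by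
    change χ x * ψ x = 1
    rw [hχ x hx, hψ x hx, one_mul]
  inv_mem' := fun {χ} hχ x hx => by
    change (χ x)⁻¹ = 1
    rw [hχ x hx, inv_one]

end

open Filter Set Topology

/-! ### Characters of discrete groups -/

/-! Both protodiscreteness and the absence of infinite compact sets pass to extensions. The latter
makes the dual topology pointwise (`isInducing_dual_coe`), and then `bidualEval` is onto
(`bidualEval_surjective`). Since `G` is Hausdorff and protodiscrete, `bidualEval` is also injective
and open. Continuity remains, and it follows once every compact set of characters annihilates an
open subgroup.

By reflexivity, `H` and `G ⧸ H` have this annihilation property. To lift it to a compact `K`,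
restrict `K` to `H` and pick an open subgroup `M` of `G` with all of `K` trivial on `M ∩ H`. On `M`,
each `χ ∈ K` then factors through the image of `M` in `G ⧸ H` and extends to a character of `G ⧸ H`,
the circle being divisible. All such extensions form a compact set, so they annihilate an open `P ≤
G ⧸ H`, and `K` annihilates `M` intersected with the preimage of `P`. -/

/-- A character of a subgroup of an abstract Abelian group extends along any injection. -/
theorem exists_circle_extension {A B : Type*} [CommGroup A] [CommGroup B] (f : A →* B)
    (hf : Function.Injective f) (χ : A →* Circle) :
    ∃ ψ : B →* Circle, ∀ a, ψ (f a) = χ a := by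
  -- Divisible Abelian groups are injective, so roots in the circle suffice.
  have hdiv : ∀ {n : ℤ}, n ≠ 0 → Function.Surjective fun z : Additive Circle => n • z := by
    intro n hn z
    have : NeZero n := ⟨hn⟩
    obtain ⟨w, hw⟩ := (Circle.isQuotientCoveringMap_zpow n).surjective z.toMul
    exact ⟨Additive.ofMul w, congrArg Additive.ofMul hw⟩
  let _ : DivisibleBy (Additive Circle) ℤ := divisibleByOfSMulRightSurj _ _ hdiv
  obtain ⟨h, hh⟩ := (Module.Baer.of_divisible (Additive Circle)).extension_property_addMonoidHom
    (MonoidHom.toAdditive f) hf (MonoidHom.toAdditive χ)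
  exact ⟨MonoidHom.toAdditive.symm h, fun a => congrArg Additive.toMul
    (DFunLike.congr_fun hh (Additive.ofMul a))⟩

/-- The embedding of the rationals modulo one into the circle. -/
noncomputable def ratCircleHom : AddCircle (1 : ℚ) →+ Additive Circle :=
  QuotientAddGroup.lift _
    { toFun := fun q : ℚ => Additive.ofMul (Circle.exp (q * (2 * Real.pi)))
      map_zero' := by simp
      map_add' := fun p q => by
        rw [← ofMul_mul, ← Circle.exp_add]
        push_cast
        rw [add_mul] }
    (by
      rintro _ ⟨n, rfl⟩
      simp [AddMonoidHom.mem_ker, Circle.exp_int_mul_two_pi n])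

theorem ratCircleHom_eq_zero {x : AddCircle (1 : ℚ)} (hx : ratCircleHom x = 0) : x = 0 := by
  obtain ⟨q, rfl⟩ := QuotientAddGroup.mk_surjective x
  have h : Circle.exp (q * (2 * Real.pi)) = 1 := congrArg Additive.toMul hx
  obtain ⟨n, hn⟩ := Circle.exp_eq_one.1 h
  have hq : (q : ℝ) = n := mul_right_cancel₀ Real.two_pi_pos.ne' hn
  have hq' : q = n := by exact_mod_cast hq
  exact (QuotientAddGroup.eq_zero_iff q).2 ⟨n, by simp [hq']⟩

/-- Characters of an abstract Abelian group separate points. -/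
theorem exists_circle_character_ne_one {B : Type*} [CommGroup B] {b : B} (hb : b ≠ 1) :
    ∃ ψ : B →* Circle, ψ b ≠ 1 := by
  obtain ⟨c, hc⟩ := CharacterModule.exists_character_apply_ne_zero_of_ne_zero
    (A := Additive B) (a := Additive.ofMul b) hb
  refine ⟨MonoidHom.toAdditive.symm (ratCircleHom.comp c), fun h => hc (ratCircleHom_eq_zero ?_)⟩
  exact congrArg Additive.ofMul h

/-- A subgroup of the circle contained in the right half circle is trivial. -/
theorem MonoidHom.eq_one_of_mapsTo_centeredArc {A : Type*} [Group A] (χ : A →* Circle)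
    (N : Subgroup A) (h : MapsTo χ N (Circle.centeredArc (Real.pi / 2))) {x : A} (hx : x ∈ N) :
    χ x = 1 :=
  Circle.eq_one_of_forall_pow_mem_centeredArc_pi_div_two fun n _ => by
    simpa using h (N.pow_mem hx n)

theorem centeredArc_pi_div_two_mem_nhds_one :
    Circle.centeredArc (Real.pi / 2) ∈ 𝓝 (1 : Circle) := by
  refine (Circle.isOpen_centeredArc _).mem_nhds ?_
  rw [Circle.mem_centeredArc (by linarith [Real.pi_pos])]
  simp [Real.pi_pos]

/-! ### Topological groups and their open subgroups -/

section

variable {G : Type*} [CommGroup G] [TopologicalSpace G] [IsTopologicalGroup G]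

/-- A homomorphism that is trivial on an open subgroup is continuous. -/
theorem MonoidHom.continuous_of_eq_one_on_isOpen (χ : G →* Circle) {N : Subgroup G}
    (hN : IsOpen (N : Set G)) (h : ∀ x ∈ N, χ x = 1) : Continuous χ := by
  refine continuous_of_continuousAt_one χ ?_
  refine (continuousAt_const (y := (1 : Circle))).congr ?_
  filter_upwards [hN.mem_nhds N.one_mem] with x hx using (h x hx).symm

/-- A homomorphism trivial on an open subgroup, as an element of the dual. -/
def dualOfOpen (χ : G →* Circle) {N : Subgroup G} (hN : IsOpen (N : Set G))
    (h : ∀ x ∈ N, χ x = 1) : PontryaginDual G :=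
  ({ χ with continuous_toFun := χ.continuous_of_eq_one_on_isOpen hN h } : G →ₜ* Circle)

/-- Points outside an open subgroup are separated from it by a continuous character. -/
theorem exists_dual_separating {N : Subgroup G} (hN : IsOpen (N : Set G)) {x : G} (hx : x ∉ N) :
    ∃ χ ∈ dualAnnihilator (N : Set G), χ x ≠ 1 := by
  obtain ⟨ψ, hψ⟩ := exists_circle_character_ne_one
    (b := (x : G ⧸ N)) (fun h => hx ((QuotientGroup.eq_one_iff x).1 h))
  have h : ∀ y ∈ N, ψ.comp (QuotientGroup.mk' N) y = 1 := fun y hy => by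
    simp [(QuotientGroup.eq_one_iff y).2 hy]
  exact ⟨dualOfOpen _ hN h, h, hψ⟩

/-- The annihilator of an open subgroup is compact. -/
theorem isCompact_dualAnnihilator {N : Subgroup G} (hN : IsOpen (N : Set G)) :
    IsCompact (dualAnnihilator (N : Set G) : Set (PontryaginDual G)) := by
  have : DiscreteTopology (G ⧸ N) := QuotientGroup.discreteTopology hN
  let π : G →ₜ* G ⧸ N :=
    { QuotientGroup.mk' N with continuous_toFun := QuotientGroup.continuous_mk }
  convert isCompact_range (PontryaginDual.map π).continuous_toFun
  ext χ
  refine ⟨fun hχ => ?_, ?_⟩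
  · refine ⟨({ QuotientGroup.lift N (χ : G →* Circle) hχ with
      continuous_toFun := continuous_of_discreteTopology } : G ⧸ N →ₜ* Circle), ?_⟩
    exact PontryaginDual.ext fun x => rfl
  · rintro ⟨ψ, rfl⟩ x hx
    change ψ (x : G ⧸ N) = 1
    rw [(QuotientGroup.eq_one_iff x).2 hx, map_one]

/-- The polar of a compact set is a neighbourhood of the identity in the dual. -/
theorem polar_mem_nhds_one {A : Type*} [CommGroup A] [TopologicalSpace A] {K : Set A}
    (hK : IsCompact K) :
    {χ : PontryaginDual A | MapsTo χ K (Circle.centeredArc (Real.pi / 2))} ∈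
      𝓝 (1 : PontryaginDual A) := by
  refine IsOpen.mem_nhds (isOpen_induced (ContinuousMap.isOpen_setOfPred_mapsTo hK
    (Circle.isOpen_centeredArc (Real.pi / 2)))) ?_
  exact fun _ _ => mem_of_mem_nhds centeredArc_pi_div_two_mem_nhds_one

theorem IsProtodiscrete.exists_subgroup {A : Type*} [CommGroup A] [TopologicalSpace A]
    (h : IsProtodiscrete A) {U : Set A} (hU : U ∈ 𝓝 (1 : A)) :
    ∃ N : Subgroup A, IsOpen (N : Set A) ∧ (N : Set A) ⊆ U := by
  simpa using (HasBasis.mem_iff h).1 hU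

theorem isProtodiscrete_of_forall {A : Type*} [CommGroup A] [TopologicalSpace A]
    (h : ∀ U ∈ 𝓝 (1 : A), ∃ N : Subgroup A, IsOpen (N : Set A) ∧ (N : Set A) ⊆ U) :
    IsProtodiscrete A :=
  ⟨fun U => ⟨fun hU => h U hU, fun ⟨N, hN, hNU⟩ => mem_of_superset (hN.mem_nhds N.one_mem) hNU⟩⟩

/-- In a reflexive protodiscrete group every compact set of characters annihilates an open
subgroup. -/
theorem IsReflexiveGroup.exists_subset_dualAnnihilator (hr : IsReflexiveGroup G)
    (hp : IsProtodiscrete G) {K : Set (PontryaginDual G)} (hK : IsCompact K) :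
    ∃ N : Subgroup G, IsOpen (N : Set G) ∧
      K ⊆ (dualAnnihilator (N : Set G) : Set (PontryaginDual G)) := by
  have hc : Tendsto (bidualEval G) (𝓝 1) (𝓝 1) := by
    simpa using hr.continuous.tendsto 1
  obtain ⟨N, hN, hNU⟩ := hp.exists_subgroup (hc (polar_mem_nhds_one hK))
  refine ⟨N, hN, fun χ hχ x hx => ?_⟩
  -- For fixed `χ ∈ K`, the image of `N` is a subgroup of the circle inside the open right half,
  -- hence trivial.
  exact MonoidHom.eq_one_of_mapsTo_centeredArc (χ : G →* Circle) N (fun y hy => hNU hy hχ) hx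

/-- An extension of a protodiscrete group by a protodiscrete group is protodiscrete. -/
theorem IsProtodiscrete.of_extension {H : Subgroup G} (hH : IsProtodiscrete H)
    (hQ : IsProtodiscrete (G ⧸ H)) : IsProtodiscrete G := by
  refine isProtodiscrete_of_forall fun U hU => ?_
  obtain ⟨V, hV, hVU⟩ := exists_nhds_one_split hU
  obtain ⟨N, hN, hNV⟩ := hH.exists_subgroup
    (U := Subtype.val ⁻¹' V) (continuous_subtype_val.continuousAt.preimage_mem_nhds hV)
  obtain ⟨O, hO, hON⟩ := isOpen_induced_iff.1 hN
  have hO1 : O ∈ 𝓝 (1 : G) := hO.mem_nhds <| by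
    have : (1 : H) ∈ Subtype.val ⁻¹' O := by rw [hON]; exact N.one_mem
    exact this
  have hO' : ∀ x ∈ O, ∀ hx : x ∈ H, (⟨x, hx⟩ : H) ∈ N := fun x hx hxH => by
    have : (⟨x, hxH⟩ : H) ∈ Subtype.val ⁻¹' O := hx
    rwa [hON] at this
  -- With `O ∩ H = N`, an element `a * b / c` lying in `H` is forced into `N`; this corrects
  -- representatives below.
  obtain ⟨W₀, hW₀, hW₀O⟩ : ∃ W ∈ 𝓝 (1 : G), ∀ a ∈ W, ∀ b ∈ W, ∀ c ∈ W, a * b / c ∈ O := by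
    have ht : Tendsto (fun p : G × G × G => p.1 * p.2.1 / p.2.2) (𝓝 (1, 1, 1)) (𝓝 1) := by
      have : Continuous fun p : G × G × G => p.1 * p.2.1 / p.2.2 := by fun_prop
      simpa using this.tendsto (1, 1, 1)
    have := ht hO1
    rw [nhds_prod_eq, nhds_prod_eq, mem_map, mem_prod_iff] at this
    obtain ⟨A, hA, B, hB, hAB⟩ := this
    obtain ⟨C, hC, D, hD, hCD⟩ := mem_prod_iff.1 hB
    exact ⟨A ∩ (C ∩ D), inter_mem hA (inter_mem hC hD), fun a ha b hb c hc =>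
      hAB (show (a, b, c) ∈ A ×ˢ B from ⟨ha.1, hCD ⟨hb.2.1, hc.2.2⟩⟩)⟩
  set W := W₀ ∩ V
  have hW : W ∈ 𝓝 (1 : G) := inter_mem hW₀ hV
  have hW1 : (1 : G) ∈ W := mem_of_mem_nhds hW
  obtain ⟨M, hM, hMW⟩ := hQ.exists_subgroup (U := (QuotientGroup.mk : G → G ⧸ H) '' W)
    (QuotientGroup.isOpenMap_coe.image_mem_nhds hW)
  have key : ∀ x ∈ W, ∀ y ∈ W, ∀ w ∈ W, (x * y / w) ∈ H → ∃ n ∈ N, x * y = w * (n : H) :=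
    fun x hx y hy w hw h =>
      ⟨⟨_, h⟩, hO' _ (hW₀O x hx.1 y hy.1 w hw.1) h, by simp⟩
  have hinv : ∀ x w : G, (w : G ⧸ H) = x → x / w ∈ H := fun x w h => by
    rw [← QuotientGroup.eq_one_iff, QuotientGroup.mk_div, h, div_self']
  -- `P` is the preimage of `M` intersected with `W * N`. As `M` lies in the image of `W`, a product
  -- or inverse again has a representative in `W`, and the correction lies in `N`.
  let P : Subgroup G :=
    { carrier := {g | (g : G ⧸ H) ∈ M ∧ ∃ w ∈ W, ∃ n ∈ N, g = w * (n : H)}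
      one_mem' := ⟨M.one_mem, 1, hW1, 1, N.one_mem, by simp⟩
      mul_mem' := by
        rintro _ _ ⟨ha, w, hw, n, hn, rfl⟩ ⟨hb, w', hw', n', hn', rfl⟩
        refine ⟨M.mul_mem ha hb, ?_⟩
        have hm := M.mul_mem ha hb
        rw [← QuotientGroup.mk_mul] at hm
        obtain ⟨v, hv, hvm⟩ := hMW hm
        have e : (v : G ⧸ H) = (w * w' : G) := by
          rw [hvm, QuotientGroup.eq]
          have : (w * ↑n * (w' * ↑n'))⁻¹ * (w * w') = ((n * n')⁻¹ : H) := by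
            push_cast
            group
            simp [mul_comm, mul_left_comm]
          rw [this]
          exact SetLike.coe_mem _
        obtain ⟨k, hk, hkw⟩ := key w hw w' hw' v hv (hinv _ _ e)
        refine ⟨v, hv, k * (n * n'), N.mul_mem hk (N.mul_mem hn hn'), ?_⟩
        push_cast
        rw [mul_mul_mul_comm, hkw, mul_assoc]
      inv_mem' := by
        rintro _ ⟨ha, w, hw, n, hn, rfl⟩
        have hm := M.inv_mem ha
        refine ⟨hm, ?_⟩
        rw [← QuotientGroup.mk_inv] at hm
        obtain ⟨v, hv, hvm⟩ := hMW hm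
        have e : (1 : G ⧸ H) = (w * v : G) := by
          rw [QuotientGroup.mk_mul, hvm, ← QuotientGroup.mk_mul, eq_comm,
            QuotientGroup.eq_one_iff]
          have : w * (w * (n : G))⁻¹ = ((n⁻¹ : H) : G) := by
            simp
          rw [this]
          exact SetLike.coe_mem _
        obtain ⟨k, hk, hkw⟩ := key w hw v hv 1 hW1 (hinv _ _ e)
        refine ⟨v, hv, k⁻¹ * n⁻¹, N.mul_mem (N.inv_mem hk) (N.inv_mem hn), ?_⟩
        push_cast
        rw [one_mul] at hkw
        rw [← hkw, mul_inv_rev, mul_inv_rev, mul_assoc, mul_inv_cancel_left, mul_comm] }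
  refine ⟨P, P.isOpen_of_mem_nhds (g := 1) ?_, ?_⟩
  · have : (QuotientGroup.mk : G → G ⧸ H) ⁻¹' M ∈ 𝓝 (1 : G) :=
      (hM.preimage QuotientGroup.continuous_mk).mem_nhds M.one_mem
    filter_upwards [hW, this] with x hx hxM
    exact ⟨hxM, x, hx, 1, N.one_mem, by simp⟩
  · rintro _ ⟨-, w, hw, n, hn, rfl⟩
    exact hVU _ hw.2 _ (hNV hn)

/-- An extension of groups without infinite compact subsets has no infinite compact subsets. -/
theorem HasNoInfiniteCompactSubsets.of_extension {H : Subgroup G} (hcl : IsClosed (H : Set G))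
    (hH : HasNoInfiniteCompactSubsets H) (hQ : HasNoInfiniteCompactSubsets (G ⧸ H)) :
    HasNoInfiniteCompactSubsets G := by
  intro K hK
  refine Set.Finite.of_finite_fibers (QuotientGroup.mk : G → G ⧸ H)
    (hQ _ (hK.image QuotientGroup.continuous_mk)) ?_
  rintro _ ⟨g, -, rfl⟩
  -- The part of `K` in the coset of `g` is a translate of a compact subset of the closed subgroup
  -- `H`.
  have hK' : IsCompact ((g * ·) ⁻¹' K) :=
    (Homeomorph.mulLeft g).isClosedEmbedding.isCompact_preimage hK
  have hf := hH _ (hcl.isClosedEmbedding_subtypeVal.isCompact_preimage hK')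
  refine (hf.image fun h : H => g * h).subset ?_
  rintro x ⟨hxK, hx⟩
  have hx' : g⁻¹ * x ∈ H := QuotientGroup.eq.1 (Eq.symm hx)
  exact ⟨⟨_, hx'⟩, by simpa using hxK, by simp⟩

/-- If compact sets are finite, the dual carries the topology of pointwise convergence. -/
theorem isInducing_dual_coe {A : Type*} [CommGroup A] [TopologicalSpace A]
    (h : HasNoInfiniteCompactSubsets A) :
    IsInducing (fun (χ : PontryaginDual A) (x : A) => χ x) := by
  have hco : IsInducing (fun (f : C(A, Circle)) (x : A) => f x) := by
    refine ⟨le_antisymm (continuous_iff_le_induced.1 ?_) ?_⟩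
    · exact continuous_pi fun x => ContinuousEvalConst.continuous_eval_const x
    refine le_generateFrom ?_
    rintro _ ⟨K, hK, U, hU, rfl⟩
    exact ⟨K.pi fun _ => U, isOpen_set_pi (h K hK) fun _ _ => hU, rfl⟩
  exact hco.comp (ContinuousMonoidHom.isInducing_toContinuousMap A Circle)

end

/-! ### Characters of precompact groups -/

section

open MeasureTheory

variable {D : Type*} [CommGroup D] [TopologicalSpace D]

/-- A character as a continuous complex-valued function. -/
noncomputable def dualToContinuousMap : PontryaginDual D →* C(D, ℂ) where
  toFun χ := ⟨fun x => (χ x : ℂ), continuous_subtype_val.comp (map_continuous χ)⟩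
  map_one' := rfl
  map_mul' _ _ := rfl

theorem dualToContinuousMap_apply (χ : PontryaginDual D) (x : D) :
    dualToContinuousMap χ x = (χ x : ℂ) :=
  rfl

theorem star_dualToContinuousMap (χ : PontryaginDual D) :
    star (dualToContinuousMap χ) = dualToContinuousMap χ⁻¹ := by
  ext x
  exact (Circle.coe_inv_eq_conj (χ x)).symm

/-- The star algebra spanned by a group of characters. -/
noncomputable def characterStarSubalgebra (S : Subgroup (PontryaginDual D)) : StarSubalgebra ℂ C(D, ℂ) where
  toSubalgebra := Algebra.adjoin ℂ (S.toSubmonoid.map dualToContinuousMap)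
  star_mem' := by
    change Algebra.adjoin ℂ (S.toSubmonoid.map dualToContinuousMap : Set C(D, ℂ)) ≤
      star (Algebra.adjoin ℂ (S.toSubmonoid.map dualToContinuousMap : Set C(D, ℂ)))
    refine Algebra.adjoin_le ?_
    rintro - ⟨χ, hχ, rfl⟩
    exact Algebra.subset_adjoin ⟨χ⁻¹, S.inv_mem hχ, (star_dualToContinuousMap χ).symm⟩

/-- Characters are closed under products, so the generated algebra is just their linear span;
integrals over it reduce to single characters. -/
theorem mem_characterStarSubalgebra_iff (S : Subgroup (PontryaginDual D)) (f : C(D, ℂ)) :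
    f ∈ characterStarSubalgebra S ↔
      f ∈ Submodule.span ℂ (dualToContinuousMap '' (S : Set (PontryaginDual D))) := by
  have h := Algebra.adjoin_eq_span ℂ (S.toSubmonoid.map dualToContinuousMap : Set C(D, ℂ))
  rw [Submonoid.closure_eq] at h
  exact SetLike.ext_iff.1 h f

variable [IsTopologicalGroup D]

/-- The integral of a nontrivial character of a compact group vanishes. -/
theorem integral_dualToContinuousMap_eq_zero [MeasurableSpace D] [BorelSpace D]
    (μ : Measure D) [μ.IsMulLeftInvariant] {χ : PontryaginDual D} (hχ : χ ≠ 1) :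
    ∫ x, dualToContinuousMap χ x ∂μ = 0 := by
  obtain ⟨d, hd⟩ : ∃ d, χ d ≠ 1 := by
    by_contra! h
    exact hχ (PontryaginDual.ext h)
  have h := integral_mul_left_eq_self (μ := μ) (fun x => dualToContinuousMap χ x) d
  simp only [dualToContinuousMap_apply, map_mul, Circle.coe_mul, integral_const_mul] at h ⊢
  by_contra hne
  exact hd (Circle.ext (mul_right_cancel₀ hne (h.trans (one_mul _).symm)))

/-- A group of characters of a compact group that separates points contains all characters. -/
theorem Subgroup.eq_top_of_separatesPoints [CompactSpace D] (S : Subgroup (PontryaginDual D))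
    (hS : ∀ x : D, (∀ χ ∈ S, χ x = 1) → x = 1) : S = ⊤ := by
  refine eq_top_iff.2 fun p _ => ?_
  by_contra hp
  let _ : MeasurableSpace D := borel D
  have : BorelSpace D := ⟨rfl⟩
  let μ : Measure D := Measure.haar
  have hint : ∀ f : C(D, ℂ), Integrable f μ := fun f =>
    f.continuous.integrable_of_hasCompactSupport (HasCompactSupport.of_compactSpace f)
  -- A character `p ∉ S` is orthogonal to the span of `S`, yet Stone–Weierstrass gives `f` in that
  -- span with `‖p - f‖ < 1`. Integrating `(p - f) * p⁻¹` yields the total mass, but its norm is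
  -- strictly smaller.
  have hzero : ∀ f ∈ characterStarSubalgebra S,
      ∫ x, (f * dualToContinuousMap p⁻¹) x ∂μ = 0 := by
    intro f hf
    rw [mem_characterStarSubalgebra_iff] at hf
    induction hf using Submodule.span_induction with
    | mem f hf =>
      obtain ⟨χ, hχ, rfl⟩ := hf
      rw [← map_mul]
      refine integral_dualToContinuousMap_eq_zero μ fun h => hp ?_
      rwa [← mul_inv_eq_one.1 h]
    | zero => simp
    | add f g _ _ hf hg =>
      rw [add_mul]
      have := integral_add (hint (f * dualToContinuousMap p⁻¹)) (hint (g * dualToContinuousMap p⁻¹))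
      rw [hf, hg, add_zero] at this
      exact this
    | smul a f _ hf =>
      rw [smul_mul_assoc]
      have := integral_smul (μ := μ) a (fun x => (f * dualToContinuousMap p⁻¹) x)
      rw [hf, smul_zero] at this
      exact this
  have hsep : (characterStarSubalgebra S).SeparatesPoints := by
    intro x y hxy
    by_contra! h
    refine hxy (mul_inv_eq_one.1 (hS _ fun χ hχ => ?_))
    have := h _ ⟨_, Algebra.subset_adjoin ⟨χ, hχ, rfl⟩, rfl⟩
    rw [map_mul, map_inv, mul_inv_eq_one]
    exact Circle.ext this
  have hmem : dualToContinuousMap p ∈ (characterStarSubalgebra S).topologicalClosure := by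
    rw [ContinuousMap.starSubalgebra_topologicalClosure_eq_top_of_separatesPoints _ hsep]
    trivial
  obtain ⟨f, hf, hpf⟩ := Metric.mem_closure_iff.1 hmem 1 one_pos
  rw [dist_eq_norm] at hpf
  have hone : dualToContinuousMap p * dualToContinuousMap p⁻¹ = 1 := by
    rw [← map_mul, mul_inv_cancel, map_one]
  have hval : ∫ x, ((dualToContinuousMap p - f) * dualToContinuousMap p⁻¹) x ∂μ =
      (μ.real univ : ℂ) := by
    have := integral_sub (hint (dualToContinuousMap p * dualToContinuousMap p⁻¹))
      (hint (f * dualToContinuousMap p⁻¹))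
    rw [hzero f hf, hone, sub_zero] at this
    rw [sub_mul, hone]
    simpa using this
  have hle := norm_integral_le_of_norm_le_const (μ := μ) (C := ‖dualToContinuousMap p - f‖)
    (f := fun x => ((dualToContinuousMap p - f) * dualToContinuousMap p⁻¹) x)
    (Eventually.of_forall fun x => by
      rw [ContinuousMap.mul_apply, norm_mul, dualToContinuousMap_apply p⁻¹, Circle.norm_coe,
        mul_one]
      exact ContinuousMap.norm_coe_le_norm _ x)
  rw [hval] at hle
  have hpos : 0 < μ.real univ := measureReal_univ_pos
  simp only [Complex.norm_real, Real.norm_of_nonneg hpos.le] at hle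
  nlinarith

end

section

variable {G : Type*} [CommGroup G] [TopologicalSpace G] [IsTopologicalGroup G]

/-- If the dual carries the topology of pointwise convergence, every character of the dual is
an evaluation. -/
theorem bidualEval_surjective
    (hind : IsInducing (fun (χ : PontryaginDual G) (x : G) => χ x)) :
    Function.Surjective (bidualEval G) := by
  intro Φ
  let j : PontryaginDual G →* (G → Circle) × Circle :=
    { toFun := fun χ => (fun x => χ x, Φ χ)
      map_one' := Prod.ext rfl (map_one Φ)
      map_mul' := fun χ ψ => Prod.ext rfl (map_mul Φ χ ψ) }
  -- The closure of the graph of `Φ` is a compact group. If the coordinates at points of `G`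
  -- separate its points, they exhaust its characters, so the last coordinate is one of them.
  let D : Subgroup ((G → Circle) × Circle) := j.range.topologicalClosure
  have : CompactSpace D :=
    isCompact_iff_compactSpace.1 j.range.isClosed_topologicalClosure.isCompact
  have hhom : ∀ d ∈ D, d.1 ∈ range ((⇑) : (G →* Circle) → G → Circle) := by
    have hcl := (MonoidHom.isClosed_range_coe G Circle).preimage
      (continuous_fst (X := G → Circle) (Y := Circle))
    refine fun d hd => closure_minimal ?_ hcl hd
    rintro _ ⟨χ, rfl⟩
    exact ⟨(χ : G →* Circle), rfl⟩
  -- Continuity of `Φ` at `1` in the pointwise topology: graph points with first entry near `1` have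
  -- last entry near `1`.
  have hker : ∀ d ∈ D, d.1 = 1 → d.2 = 1 := by
    rintro ⟨a, z⟩ hd rfl
    by_contra hz
    obtain ⟨U, V, hU, hV, hzU, h1V, hUV⟩ := t2_separation hz
    have hΦ : Φ ⁻¹' V ∈ 𝓝 (1 : PontryaginDual G) :=
      (hV.preimage (map_continuous Φ)).mem_nhds (by simpa using h1V)
    rw [hind.nhds_eq_comap] at hΦ
    obtain ⟨W, hW, hWV⟩ := hΦ
    obtain ⟨d, hd, χ, rfl⟩ := mem_closure_iff_nhds.1 hd (W ×ˢ U)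
      (prod_mem_nhds hW (hU.mem_nhds hzU))
    exact hUV.le_bot ⟨hd.2, hWV hd.1⟩
  let e : G →* PontryaginDual D :=
    { toFun := fun g =>
        ({ toFun := fun d => d.1.1 g
           map_one' := rfl
           map_mul' := fun _ _ => rfl
           continuous_toFun := by fun_prop } : D →ₜ* Circle)
      map_one' := PontryaginDual.ext fun d => by
        obtain ⟨f, hf⟩ := hhom d d.2
        change d.1.1 1 = 1
        rw [← hf, map_one]
      map_mul' := fun g h => PontryaginDual.ext fun d => by
        obtain ⟨f, hf⟩ := hhom d d.2
        change d.1.1 (g * h) = d.1.1 g * d.1.1 h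
        rw [← hf, map_mul] }
  let p : PontryaginDual D :=
    ({ toFun := fun d => d.1.2
       map_one' := rfl
       map_mul' := fun _ _ => rfl
       continuous_toFun := by fun_prop } : D →ₜ* Circle)
  have htop : e.range = ⊤ := by
    refine Subgroup.eq_top_of_separatesPoints _ fun d hd => ?_
    have h1 : d.1.1 = 1 := funext fun g => hd (e g) ⟨g, rfl⟩
    exact Subtype.ext (Prod.ext h1 (hker d d.2 h1))
  obtain ⟨g, hg⟩ : p ∈ e.range := htop ▸ Subgroup.mem_top p
  refine ⟨g, PontryaginDual.ext fun χ => ?_⟩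
  exact DFunLike.congr_fun hg ⟨j χ, j.range.le_topologicalClosure ⟨χ, rfl⟩⟩

end

/-! ### Extensions -/

section

variable {G : Type*} [CommGroup G] [TopologicalSpace G] [IsTopologicalGroup G]

/-- A homomorphism from a quotient that agrees on an open subgroup with a continuous character is
continuous. -/
theorem MonoidHom.continuous_quotient_of_eqOn {H M : Subgroup G} (hM : IsOpen (M : Set G))
    (ψ : G ⧸ H →* Circle) (χ : PontryaginDual G) (h : ∀ x ∈ M, ψ (x : G ⧸ H) = χ x) :
    Continuous ψ := by
  refine QuotientGroup.isOpenQuotientMap_mk.isQuotientMap.continuous_iff.2 ?_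
  refine continuous_of_continuousAt_one (ψ.comp (QuotientGroup.mk' H)) ?_
  refine (map_continuous χ).continuousAt.congr ?_
  filter_upwards [hM.mem_nhds M.one_mem] with x hx using (h x hx).symm

/-- A continuous character that is trivial on `M ∩ H`, with `M` an open subgroup, agrees on `M`
with a continuous character of the quotient by `H`. -/
theorem exists_dual_quotient_eqOn {H M : Subgroup G} (hM : IsOpen (M : Set G))
    (χ : PontryaginDual G) (h : ∀ x ∈ M, x ∈ H → χ x = 1) :
    ∃ ψ : PontryaginDual (G ⧸ H), ∀ x ∈ M, ψ (x : G ⧸ H) = χ x := by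
  let g : M →* G ⧸ H := (QuotientGroup.mk' H).comp M.subtype
  -- The quotient of `M` by `M ∩ H` embeds in `G ⧸ H`. The extension is continuous because it
  -- matches `χ` on the open `M`.
  obtain ⟨ψ, hψ⟩ := exists_circle_extension (QuotientGroup.kerLift g)
    (QuotientGroup.kerLift_injective g)
    (QuotientGroup.lift g.ker ((χ : G →* Circle).comp M.subtype) fun x hx =>
      h x x.2 ((QuotientGroup.eq_one_iff _).1 hx))
  have hψM : ∀ x ∈ M, ψ (x : G ⧸ H) = χ x := fun x hx => hψ ((⟨x, hx⟩ : M) : M ⧸ g.ker)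
  exact ⟨({ ψ with continuous_toFun := ψ.continuous_quotient_of_eqOn hM χ hψM } :
    G ⧸ H →ₜ* Circle), hψM⟩

/-- If the dual of the quotient carries the topology of pointwise convergence, the characters of
the quotient that agree on an open subgroup with a member of a compact set of characters form a
compact set. -/
theorem isCompact_dual_quotient_eqOn {H M : Subgroup G} (hM : IsOpen (M : Set G))
    (hind : IsInducing (fun (ψ : PontryaginDual (G ⧸ H)) (x : G ⧸ H) => ψ x))
    {K : Set (PontryaginDual G)} (hK : IsCompact K) :
    IsCompact {ψ : PontryaginDual (G ⧸ H) | ∃ χ ∈ K, ∀ x ∈ M, ψ (x : G ⧸ H) = χ x} := by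
  rw [hind.isCompact_iff]
  -- The set is the projection of a closed subset of the compact product of `G ⧸ H → Circle` with
  -- `K`; continuity of the first entry is automatic.
  have hcl : IsClosed {p : (G ⧸ H → Circle) × PontryaginDual G |
      p.1 ∈ range ((⇑) : (G ⧸ H →* Circle) → G ⧸ H → Circle) ∧
        ∀ x ∈ M, p.1 (x : G ⧸ H) = p.2 x} := by
    have heq : IsClosed {p : (G ⧸ H → Circle) × PontryaginDual G |
        ∀ x ∈ M, p.1 (x : G ⧸ H) = p.2 x} := by
      simp only [Set.ofPred_forall]
      refine isClosed_iInter fun x => isClosed_iInter fun _ => isClosed_eq (by fun_prop) ?_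
      exact ((ContinuousMonoidHom.instContinuousEvalConst G Circle).continuous_eval_const x).comp
        continuous_snd
    exact ((MonoidHom.isClosed_range_coe (G ⧸ H) Circle).preimage continuous_fst).inter heq
  convert (((isCompact_univ (X := G ⧸ H → Circle)).prod hK).inter_right hcl).image
    continuous_fst using 1
  ext a
  constructor
  · rintro ⟨ψ, ⟨χ, hχ, hψ⟩, rfl⟩
    exact ⟨(ψ, χ), ⟨⟨mem_univ _, hχ⟩, ⟨(ψ : G ⧸ H →* Circle), rfl⟩, hψ⟩, rfl⟩
  · rintro ⟨⟨_, χ⟩, ⟨⟨-, hχ⟩, ⟨ψ, rfl⟩, hψ⟩, rfl⟩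
    exact ⟨({ ψ with continuous_toFun := ψ.continuous_quotient_of_eqOn hM χ hψ } :
      G ⧸ H →ₜ* Circle), ⟨χ, hχ, hψ⟩, rfl⟩

/-- Compact sets of characters of a protodiscrete group annihilate open subgroups as soon as this
holds for a subgroup and for the quotient by it. -/
theorem IsProtodiscrete.exists_subset_dualAnnihilator_of_extension (hG : IsProtodiscrete G)
    {H : Subgroup G}
    (hind : IsInducing (fun (ψ : PontryaginDual (G ⧸ H)) (x : G ⧸ H) => ψ x))
    (hH : ∀ K : Set (PontryaginDual H), IsCompact K → ∃ N : Subgroup H,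
      IsOpen (N : Set H) ∧ K ⊆ (dualAnnihilator (N : Set H) : Set (PontryaginDual H)))
    (hQ : ∀ K : Set (PontryaginDual (G ⧸ H)), IsCompact K → ∃ N : Subgroup (G ⧸ H),
      IsOpen (N : Set (G ⧸ H)) ∧
        K ⊆ (dualAnnihilator (N : Set (G ⧸ H)) : Set (PontryaginDual (G ⧸ H))))
    {K : Set (PontryaginDual G)} (hK : IsCompact K) :
    ∃ N : Subgroup G, IsOpen (N : Set G) ∧
      K ⊆ (dualAnnihilator (N : Set G) : Set (PontryaginDual G)) := by
  let ι : H →ₜ* G := { H.subtype with continuous_toFun := continuous_subtype_val }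
  obtain ⟨N, hN, hKN⟩ := hH _ (hK.image (PontryaginDual.map ι).continuous_toFun)
  obtain ⟨O, hO, hON⟩ := isOpen_induced_iff.1 hN
  have hNO : ∀ x : H, x ∈ N ↔ (x : G) ∈ O := fun x => (Set.ext_iff.1 hON x).symm
  obtain ⟨M, hM, hMO⟩ := hG.exists_subgroup (hO.mem_nhds ((hNO 1).1 N.one_mem))
  have hKM : ∀ χ ∈ K, ∀ x ∈ M, x ∈ H → χ x = 1 := fun χ hχ x hx hxH =>
    hKN ⟨χ, hχ, rfl⟩ ⟨x, hxH⟩ ((hNO _).2 (hMO hx))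
  obtain ⟨P, hP, hKP⟩ := hQ _ (isCompact_dual_quotient_eqOn hM hind hK)
  refine ⟨M ⊓ P.comap (QuotientGroup.mk' H),
    hM.inter (hP.preimage QuotientGroup.continuous_mk), fun χ hχ x hx => ?_⟩
  obtain ⟨ψ, hψ⟩ := exists_dual_quotient_eqOn hM χ (hKM χ hχ)
  rw [← hψ x hx.1]
  exact hKP ⟨χ, hχ, hψ⟩ _ hx.2

/-- A protodiscrete Hausdorff group without infinite compact subsets is reflexive if every
compact set of characters annihilates an open subgroup. -/
theorem IsProtodiscrete.isReflexiveGroup [T1Space G] (hG : IsProtodiscrete G)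
    (hc : HasNoInfiniteCompactSubsets G)
    (hK : ∀ K : Set (PontryaginDual G), IsCompact K → ∃ N : Subgroup G, IsOpen (N : Set G) ∧
      K ⊆ (dualAnnihilator (N : Set G) : Set (PontryaginDual G))) :
    IsReflexiveGroup G := by
  have hsurj := bidualEval_surjective (isInducing_dual_coe hc)
  have hinj : Function.Injective (bidualEval G) := by
    refine (injective_iff_map_eq_one _).2 fun x hx => ?_
    by_contra hne
    obtain ⟨N, hN, hNx⟩ := hG.exists_subgroup (isOpen_compl_singleton.mem_nhds (Ne.symm hne))
    obtain ⟨χ, -, hχ⟩ := exists_dual_separating hN fun hxN => hNx hxN rfl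
    exact hχ (DFunLike.congr_fun hx χ)
  have hcont : Continuous (bidualEval G) := by
    refine (ContinuousMonoidHom.isInducing_toContinuousMap _ _).continuous_iff.2
      (ContinuousMap.continuous_compactOpen.2 fun K hKc U _ => ?_)
    obtain ⟨N, hN, hKN⟩ := hK K hKc
    refine isOpen_iff_mem_nhds.2 fun x hx => ?_
    have : (x⁻¹ * ·) ⁻¹' (N : Set G) ∈ 𝓝 x :=
      (hN.preimage (continuous_const_mul _)).mem_nhds (by simp [N.one_mem])
    filter_upwards [this] with y hy χ hχ
    have h1 : χ (x⁻¹ * y) = 1 := hKN hχ _ hy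
    rw [map_mul, map_inv, inv_mul_eq_one] at h1
    change χ y ∈ U
    rw [← h1]
    exact hx hχ
  refine ⟨hcont, ?_, hinj, hsurj⟩
  refine IsTopologicalGroup.isOpenMap_iff_nhds_one.2 fun U hU => ?_
  obtain ⟨N, hN, hNU⟩ := hG.exists_subgroup (mem_map.1 hU)
  -- If the evaluation at `x` sends the compact group `N^⊥` into the right half circle, it is
  -- trivial there, so `x ∈ N` by separation.
  refine mem_of_superset (polar_mem_nhds_one (isCompact_dualAnnihilator hN)) fun Φ hΦ => ?_
  obtain ⟨x, rfl⟩ := hsurj Φ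
  refine hNU ?_
  by_contra hx
  obtain ⟨χ, hχ, hχx⟩ := exists_dual_separating hN hx
  exact hχx (MonoidHom.eq_one_of_mapsTo_centeredArc (bidualEval G x : PontryaginDual G →* Circle)
    (dualAnnihilator (N : Set G)) hΦ hχ)

end

theorem mainTheorem3 {G : Type*} [CommGroup G] [TopologicalSpace G] [IsTopologicalGroup G]
    (H : Subgroup G) (hH : IsClosed (H : Set G))
    (hHc : HasNoInfiniteCompactSubsets H) (hQc : HasNoInfiniteCompactSubsets (G ⧸ H))
    (hHr : IsReflexiveGroup H) (hQr : IsReflexiveGroup (G ⧸ H))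
    (hHp : IsProtodiscrete H) (hQp : IsProtodiscrete (G ⧸ H)) :
    IsReflexiveGroup G ∧ IsProtodiscrete G ∧
      ∀ K : Set (PontryaginDual G), IsCompact K →
        ∃ N : Subgroup G, IsOpen (N : Set G) ∧
          K ⊆ (dualAnnihilator (N : Set G) : Set (PontryaginDual G)) := by
  have hGp : IsProtodiscrete G := hHp.of_extension hQp
  have hK : ∀ K : Set (PontryaginDual G), IsCompact K → ∃ N : Subgroup G, IsOpen (N : Set G) ∧
      K ⊆ (dualAnnihilator (N : Set G) : Set (PontryaginDual G)) := fun K hK =>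
    hGp.exists_subset_dualAnnihilator_of_extension (isInducing_dual_coe hQc)
      (fun _ => hHr.exists_subset_dualAnnihilator hHp)
      (fun _ => hQr.exists_subset_dualAnnihilator hQp) hK
  -- Reflexivity embeds `H` in its Hausdorff bidual, so `{1}` is closed in `H`, hence in `G`.
  have : T2Space H := hHr.isEmbedding.t2Space
  have hone : IsClosed ({1} : Set G) := by
    simpa using hH.isClosedEmbedding_subtypeVal.isClosedMap {1} isClosed_singleton
  have : T1Space G := IsTopologicalGroup.t1Space G hone
  exact ⟨hGp.isReflexiveGroup (hHc.of_extension hH hQc) hK, hGp, hK⟩
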